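/- Let $k$ be a commutative ring with $1$ and let $I$ be a well-ordered set; let $I_s \subseteq I$ be the set of successors, i.e. of those elements of $I$ that have an immediate predecessor. A $k$-functor is a functor from (commutative) $k$-algebras to sets. Let $\mathrm{GL}_{I_s}$ be the $k$-functor which sends a $k$-algebra $R$ to the group of invertible column-finite $I_s \times I_s$ matrices over $R$ (every column has finite support, and the inverse is again column-finite), and let $B \subseteq \mathrm{GL}_{I_s}$ be the subgroup functor of upper triangular matrices, $B(R) = \{[x_{i,j}] \in \mathrm{GL}_{I_s}(R) \mid x_{i,j} = 0 \text{ for } i > j\}$. For a permutation $\sigma \in \mathrm{Perm}(I_s)$, denote its permutation matrix (with $j$-th column the standard basis vector $e_{\sigma(j)}$) also by $\sigma$, let $B\sigma B \subseteq \mathrm{GL}_{I_s}$ be the subfunctor $R \mapsto B(R)\,\sigma\, B(R)$, and let $\operatorname{sh}(B\sigma B) \subseteq \mathrm{GL}_{I_s}$ be its fppf sheafification inside the fppf sheaf $\mathrm{GL}_{I_s}$: an element $g \in \mathrm{GL}_{I_s}(R)$ lies in $\operatorname{sh}(B\sigma B)(R)$ if and only if its images lie in $B(R_i)\,\sigma\,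 B(R_i)$ for all members of some fppf covering family of $R$, that is, a finite family $R_1, \dots, R_n$ of finitely presented $R$-algebras whose product is faithfully flat over $R$. Then the subfunctors $\operatorname{sh}(B\sigma B)$, $\sigma \in \mathrm{Perm}(I_s)$, of $\mathrm{GL}_{I_s}$ are pairwise disjoint and cover $\mathrm{GL}_{I_s}$. Explicitly: 1. if $\sigma \neq \tau$, then $\operatorname{sh}(B\sigma B)(R) \cap \operatorname{sh}(B\tau B)(R) = \emptyset$ for every nonzero $k$-algebra $R$; 2. for every $k$-algebra $R$ which is a field, $\mathrm{GL}_{I_s}(R) = \bigcup_{\sigma \in \mathrm{Perm}(I_s)} \operatorname{sh}(B\sigma B)(R)$. -/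

import Mathlib

open CategoryTheory Opposite

universe w v u

/-! ### Column-finite matrices and the general linear group of an arbitrary index set -/

/-- An `ι × ι` matrix over `R` all of whose columns have finite support, stored by columns:
`x.col j` is the `j`-th column. -/
structure ColFinMatrix (ι : Type w) (R : Type v) [CommRing R] : Type (max w v) where
  col : ι → (ι →₀ R)

namespace ColFinMatrix

variable {ι : Type w} {R : Type v} [CommRing R]

/-- The entry in row `i` and column `j`. -/
def entry (x : ColFinMatrix ι R) (i j : ι) : R := x.col j i

@[ext]
theorem ext {x y : ColFinMatrix ι R} (h : ∀ i j, x.entry i j = y.entry i j) : x = y := by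
  obtain ⟨x⟩ := x
  obtain ⟨y⟩ := y
  exact congrArg mk (funext fun j => Finsupp.ext fun i => h i j)

/-- The product: the `j`-th column of `x * y` is the linear combination of the columns of `x`
whose coefficients are the entries of the `j`-th column of `y`. -/
noncomputable instance : Mul (ColFinMatrix ι R) :=
  ⟨fun x y => ⟨fun j => Finsupp.linearCombination R x.col (y.col j)⟩⟩

/-- The identity matrix. -/
noncomputable instance : One (ColFinMatrix ι R) := ⟨⟨fun j => Finsupp.single j 1⟩⟩

theorem mul_col (x y : ColFinMatrix ι R) (j : ι) :
    (x * y).col j = Finsupp.linearCombination R x.col (y.col j) := rfl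

theorem one_col (j : ι) : (1 : ColFinMatrix ι R).col j = Finsupp.single j 1 := rfl

theorem ext_col {x y : ColFinMatrix ι R} (h : ∀ j, x.col j = y.col j) : x = y :=
  ext fun i j => DFunLike.congr_fun (h j) i

theorem mul_entry (x y : ColFinMatrix ι R) (i j : ι) :
    (x * y).entry i j = (y.col j).sum fun n a => x.entry i n * a := by
  rw [entry, mul_col, Finsupp.linearCombination_apply, Finsupp.sum, Finsupp.finsetSum_apply]
  refine Finset.sum_congr rfl fun n _ => ?_
  rw [Finsupp.smul_apply, smul_eq_mul, mul_comm]
  rfl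

/-- Multiplication is the usual matrix multiplication. -/
theorem mul_entry_eq_finsum (x y : ColFinMatrix ι R) (i j : ι) :
    (x * y).entry i j = ∑ᶠ n, x.entry i n * y.entry n j := by
  rw [mul_entry, Finsupp.sum]
  symm
  refine finsum_eq_sum_of_support_subset _ fun n hn => ?_
  rw [Finset.mem_coe, Finsupp.mem_support_iff]
  intro h
  refine hn ?_
  change x.entry i n * (y.col j) n = 0
  rw [h, mul_zero]

theorem one_entry [DecidableEq ι] (i j : ι) :
    (1 : ColFinMatrix ι R).entry i j = if i = j then 1 else 0 := by
  rw [entry, one_col, Finsupp.single_apply]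
  simp only [eq_comm]

noncomputable instance : Monoid (ColFinMatrix ι R) where
  mul_assoc x y z := ext_col fun j => by
    simp only [mul_col]
    rw [Finsupp.linearCombination_apply, Finsupp.linearCombination_apply R (z.col j),
      Finsupp.sum, Finsupp.sum, map_sum]
    simp only [map_smul, mul_col]
  one_mul x := ext_col fun j => by
    rw [mul_col, Finsupp.linearCombination_apply]
    simp only [one_col]
    simp
  mul_one x := ext_col fun j => by
    rw [mul_col, one_col, Finsupp.linearCombination_single, one_smul]

/-- Applying a ring homomorphism to all entries. -/
noncomputable def map {S : Type v} [CommRing S] (φ : R →+* S) :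
    ColFinMatrix ι R →* ColFinMatrix ι S where
  toFun x := ⟨fun j => (x.col j).mapRange φ (map_zero φ)⟩
  map_one' := ext_col fun j => by simp [one_col]
  map_mul' x y := by
    ext i j
    change φ ((x * y).entry i j) = _
    rw [mul_entry, mul_entry, map_finsuppSum, Finsupp.sum_mapRange_index (by simp)]
    refine Finsupp.sum_congr fun n _ => ?_
    rw [map_mul]
    rfl

theorem map_entry {S : Type v} [CommRing S] (φ : R →+* S) (x : ColFinMatrix ι R) (i j : ι) :
    (map φ x).entry i j = φ (x.entry i j) := rfl

end ColFinMatrix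

/-- The general linear group of invertible column-finite `ι × ι` matrices (the inverse being
column-finite as well). -/
abbrev GLGroup (ι : Type w) (R : Type v) [CommRing R] : Type (max w v) := (ColFinMatrix ι R)ˣ

/-- The permutation matrix of `σ`: column `j` is the standard basis vector at `σ j`. -/
noncomputable def permMatrix {ι : Type w} (R : Type v) [CommRing R] (σ : Equiv.Perm ι) :
    GLGroup ι R where
  val := ⟨fun j => Finsupp.single (σ j) 1⟩
  inv := ⟨fun j => Finsupp.single (σ.symm j) 1⟩
  val_inv := ColFinMatrix.ext_col fun j => by simp [ColFinMatrix.mul_col, ColFinMatrix.one_col]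
  inv_val := ColFinMatrix.ext_col fun j => by simp [ColFinMatrix.mul_col, ColFinMatrix.one_col]

theorem permMatrix_entry {ι : Type w} [DecidableEq ι] (R : Type v) [CommRing R]
    (σ : Equiv.Perm ι) (i j : ι) :
    (permMatrix R σ).val.entry i j = if i = σ j then 1 else 0 := by
  change (Finsupp.single (σ j) (1 : R)) i = _
  rw [Finsupp.single_apply]
  simp only [eq_comm]

/-- The inverse of an invertible upper triangular matrix over a well-ordered index set is upper
triangular. -/
theorem GLGroup.inv_upper {ι : Type w} [LinearOrder ι] [WellFoundedLT ι] {R : Type v}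
    [CommRing R] (x : GLGroup ι R) (hx : ∀ i j, j < i → x.val.entry i j = 0) (j : ι) :
    ∀ i, j < i → x.inv.entry i j = 0 := by
  classical
  induction j using WellFoundedLT.induction with
  | ind j ih =>
    have key : ∀ i, j ≤ i →
        (x.inv * x.val).entry i j = x.inv.entry i j * x.val.entry j j := by
      intro i hi
      rw [ColFinMatrix.mul_entry_eq_finsum]
      refine finsum_eq_single _ j fun n hn => ?_
      rcases lt_or_gt_of_ne hn with h | h
      · rw [ih n h i (lt_of_lt_of_le h hi), zero_mul]
      · rw [hx n j h, mul_zero]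
    have h1 := key j le_rfl
    rw [x.inv_val, ColFinMatrix.one_entry, if_pos rfl] at h1
    intro i hi
    have h2 := key i hi.le
    rw [x.inv_val, ColFinMatrix.one_entry, if_neg hi.ne'] at h2
    calc x.inv.entry i j = x.inv.entry i j * (x.inv.entry j j * x.val.entry j j) := by
          rw [← h1, mul_one]
      _ = (x.inv.entry i j * x.val.entry j j) * x.inv.entry j j := by ring
      _ = 0 := by rw [← h2, zero_mul]

/-- The subgroup of upper triangular matrices: the `(i, j)` entry vanishes whenever `i > j`. -/
def upperTriangular (ι : Type w) [LinearOrder ι] [WellFoundedLT ι] (R : Type v) [CommRing R] :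
    Subgroup (GLGroup ι R) where
  carrier := {x | ∀ i j, j < i → x.val.entry i j = 0}
  one_mem' := by
    classical
    intro i j h
    rw [Units.val_one, ColFinMatrix.one_entry, if_neg h.ne']
  mul_mem' := by
    intro x y hx hy i j h
    rw [Units.val_mul, ColFinMatrix.mul_entry_eq_finsum]
    refine finsum_eq_zero_of_forall_eq_zero fun n => ?_
    rcases lt_or_ge n i with hn | hn
    · rw [hx i n hn, zero_mul]
    · rw [hy n j (lt_of_lt_of_le h hn), mul_zero]
  inv_mem' := by
    intro x hx i j h
    exact x.inv_upper hx j i h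

theorem upperTriangular_map {ι : Type w} [LinearOrder ι] [WellFoundedLT ι] {R S : Type v}
    [CommRing R] [CommRing S] (φ : R →+* S) {x : GLGroup ι R} (hx : x ∈ upperTriangular ι R) :
    Units.map (ColFinMatrix.map φ) x ∈ upperTriangular ι S := by
  intro i j h
  change φ (x.val.entry i j) = 0
  rw [hx i j h, map_zero]

theorem permMatrix_map {ι : Type w} {R S : Type v} [CommRing R] [CommRing S] (φ : R →+* S)
    (σ : Equiv.Perm ι) :
    Units.map (ColFinMatrix.map φ) (permMatrix R σ) = permMatrix S σ := by
  classical
  ext i j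
  change φ ((permMatrix R σ).val.entry i j) = _
  rw [permMatrix_entry, permMatrix_entry]
  split_ifs <;> simp

/-! ### `k`-functors, the fppf topology and fppf sheafification of subfunctors -/

section Fppf

variable (k : Type u) [CommRing k]

/-- A finite family of `k`-algebra maps out of `R` is an fppf covering family if every `A i` is a
finitely presented `R`-algebra and the product of the `A i` is a faithfully flat `R`-algebra. -/
def IsFppfCover {k : Type u} [CommRing k] {ι : Type} {R : CommAlgCat.{v} k}
    (A : ι → CommAlgCat.{v} k) (f : ∀ i, R ⟶ A i) : Prop :=
  (∀ i, (f i).hom.toRingHom.FinitePresentation) ∧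
    (RingHom.pi fun i => (f i).hom.toRingHom).FaithfullyFlat

theorem isFppfCover_iff {k : Type u} [CommRing k] {ι : Type} [Finite ι] {R : CommAlgCat.{v} k}
    (A : ι → CommAlgCat.{v} k) (f : ∀ i, R ⟶ A i) :
    IsFppfCover A f ↔ (∀ i, (f i).hom.toRingHom.FinitePresentation) ∧
      (∀ i, (f i).hom.toRingHom.Flat) ∧
      ∀ p : PrimeSpectrum R, ∃ i, ∃ q : PrimeSpectrum (A i),
        PrimeSpectrum.comap (f i).hom.toRingHom q = p := by
  classical
  cases nonempty_fintype ι
  rw [IsFppfCover, RingHom.FaithfullyFlat.iff_flat_and_comap_surjective]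
  refine and_congr_right fun _ => and_congr ?_ ?_
  · let := fun i => (f i).hom.toRingHom.toAlgebra
    have h : Module.Flat R (∀ i, A i) ↔ ∀ i, Module.Flat R (A i) := by
      rw [← Module.Flat.dfinsupp_iff]
      exact Module.Flat.equiv_iff (DFinsupp.linearEquivFunOnFintype (R := R)).symm
    exact h
  · constructor
    · intro h p
      obtain ⟨q, rfl⟩ := h p
      obtain ⟨i, q, rfl⟩ := PrimeSpectrum.exists_comap_evalRingHom_eq q
      exact ⟨i, q, rfl⟩
    · intro h p
      obtain ⟨i, q, rfl⟩ := h p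
      exact ⟨PrimeSpectrum.comap (Pi.evalRingHom (fun i => A i) i) q, rfl⟩

theorem IsFppfCover.id {k : Type u} [CommRing k] (R : CommAlgCat.{v} k) :
    IsFppfCover (fun _ : Unit => R) (fun _ => 𝟙 R) := by
  rw [isFppfCover_iff]
  exact ⟨fun _ => RingHom.FinitePresentation.id R, fun _ => RingHom.Flat.id R,
    fun p => ⟨(), p, rfl⟩⟩

/-- Fppf covering families compose. -/
theorem IsFppfCover.comp {k : Type u} [CommRing k] {ι : Type} [Finite ι] {κ : ι → Type}
    [∀ i, Finite (κ i)] {R : CommAlgCat.{v} k} {A : ι → CommAlgCat.{v} k} {f : ∀ i, R ⟶ A i}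
    (hf : IsFppfCover A f) {C : ∀ i, κ i → CommAlgCat.{v} k} {g : ∀ i j, A i ⟶ C i j}
    (hg : ∀ i, IsFppfCover (C i) (g i)) :
    IsFppfCover (fun x : Sigma κ => C x.1 x.2) (fun x => f x.1 ≫ g x.1 x.2) := by
  simp only [isFppfCover_iff] at hf hg ⊢
  refine ⟨fun x => ((hg x.1).1 x.2).comp (hf.1 x.1),
    fun x => (hf.2.1 x.1).comp ((hg x.1).2.1 x.2), fun p => ?_⟩
  obtain ⟨i, q, rfl⟩ := hf.2.2 p
  obtain ⟨j, r, rfl⟩ := (hg i).2.2 q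
  exact ⟨⟨i, j⟩, r, rfl⟩

/-- Fppf covering families are stable under base change. -/
theorem IsFppfCover.exists_baseChange {k : Type u} [CommRing k] {ι : Type} [Finite ι]
    {R T : CommAlgCat.{v} k} {A : ι → CommAlgCat.{v} k} {f : ∀ i, R ⟶ A i}
    (hf : IsFppfCover A f) (t : R ⟶ T) :
    ∃ (C : ι → CommAlgCat.{v} k) (g : ∀ i, T ⟶ C i) (s : ∀ i, A i ⟶ C i),
      IsFppfCover C g ∧ ∀ i, f i ≫ s i = t ≫ g i := by
  classical
  cases nonempty_fintype ι
  let : Algebra R T := t.hom.toRingHom.toAlgebra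
  let : ∀ i, Algebra R (A i) := fun i => (f i).hom.toRingHom.toAlgebra
  have : IsScalarTower k R T := .of_algebraMap_eq fun x => (t.hom.commutes x).symm
  have : ∀ i, IsScalarTower k R (A i) := fun i =>
    .of_algebraMap_eq fun x => ((f i).hom.commutes x).symm
  obtain ⟨hfp, hff⟩ := hf
  have : ∀ i, Algebra.FinitePresentation R (A i) := hfp
  have : Module.FaithfullyFlat R (∀ i, A i) := hff
  refine ⟨fun i => CommAlgCat.of k (TensorProduct R T (A i)),
    fun i => CommAlgCat.ofHom
      ((Algebra.TensorProduct.includeLeft : T →ₐ[T] TensorProduct R T (A i)).restrictScalars k),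
    fun i => CommAlgCat.ofHom
      ((Algebra.TensorProduct.includeRight : A i →ₐ[R] TensorProduct R T (A i)).restrictScalars k),
    ⟨fun i => ?_, ?_⟩, fun i => ?_⟩
  · have : (algebraMap T (TensorProduct R T (A i))).FinitePresentation :=
      RingHom.finitePresentation_algebraMap.mpr inferInstance
    exact this
  · have : Module.FaithfullyFlat T (∀ i, TensorProduct R T (A i)) :=
      Module.FaithfullyFlat.of_linearEquiv T (TensorProduct R T (∀ i, A i))
        (Algebra.TensorProduct.piRight R T T (fun i => (A i : Type v))).symm.toLinearEquiv
    have := RingHom.faithfullyFlat_algebraMap_iff.mpr this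
    exact this
  · ext x
    exact (Algebra.TensorProduct.includeRight : A i →ₐ[R] TensorProduct R T (A i)).commutes x
      |>.trans ((Algebra.TensorProduct.algebraMap_apply x).trans rfl)

/-- The fppf topology on the opposite of the category of `k`-algebras: a sieve is covering if it
contains a finite fppf covering family. -/
def fppfTopology : GrothendieckTopology (CommAlgCat.{v} k)ᵒᵖ where
  sieves X := {S | ∃ (ι : Type) (_ : Finite ι) (A : ι → CommAlgCat.{v} k)
    (f : ∀ i, X.unop ⟶ A i), IsFppfCover A f ∧ ∀ i, S (f i).op}
  top_mem' X := ⟨Unit, inferInstance, _, _, IsFppfCover.id X.unop, fun _ => trivial⟩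
  pullback_stable' := by
    rintro X Y S t ⟨ι, hι, A, f, hf, hS⟩
    obtain ⟨C, g, s, hg, hs⟩ := hf.exists_baseChange t.unop
    refine ⟨ι, hι, C, g, hg, fun i => ?_⟩
    change S ((g i).op ≫ t)
    have h : (g i).op ≫ t = (s i).op ≫ (f i).op := congrArg Quiver.Hom.op (hs i).symm
    rw [h]
    exact S.downward_closed (hS i) _
  transitive' := by
    rintro X S ⟨ι, hι, A, f, hf, hS⟩ T hT
    choose κ hκ C g hg hgT using fun i => hT (hS i)
    exact ⟨Sigma κ, inferInstance, _, _, hf.comp hg, fun x => hgT x.1 x.2⟩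

variable {k}

/-- The sheafification of a subfunctor `Y` of a `k`-functor `X` for the fppf topology, as a
subfunctor of `X`. (It is the fppf sheafification of `Y` as soon as `X` is an fppf sheaf.) -/
def fppfSheafify {X : CommAlgCat.{v} k ⥤ Type w} (Y : Subfunctor X) : Subfunctor X where
  obj R := ((Subfunctor.mk (F := unopUnop _ ⋙ X) (fun U => Y.obj U.unop.unop)
    (fun i => Y.map i.unop.unop)).sheafify (fppfTopology k)).obj (op (op R))
  map i := Subfunctor.map (Subfunctor.sheafify (fppfTopology k) _) i.op.op

/-- Two subfunctors of a `k`-functor are disjoint if their values at every nonzero `k`-algebra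
are disjoint. -/
def SubfunctorsDisjoint {X : CommAlgCat.{v} k ⥤ Type w} (Y Z : Subfunctor X) : Prop :=
  ∀ R : CommAlgCat.{v} k, Nontrivial R → Disjoint (Y.obj R) (Z.obj R)

/-- A family of subfunctors covers a `k`-functor if it does so on `k`-algebras which are fields. -/
def SubfunctorsCover {X : CommAlgCat.{v} k ⥤ Type w} {α : Type*} (Y : α → Subfunctor X) : Prop :=
  ∀ R : CommAlgCat.{v} k, IsField R → ⋃ a, (Y a).obj R = Set.univ

end Fppf

/-! ### The general linear functor and the double cosets -/

section GeneralLinear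

variable (k : Type u) [CommRing k]

/-- The general linear `k`-functor attached to the index set `ι`. -/
noncomputable def glFunctor (ι : Type w) : CommAlgCat.{v} k ⥤ Type (max w v) where
  obj R := GLGroup ι R
  map f := ↾(fun g => Units.map (ColFinMatrix.map f.hom.toRingHom) g)
  map_id R := by
    ext g
    rfl
  map_comp f g := by
    ext x
    rfl

/-- The subfunctor `R ↦ B(R) σ B(R)` of the general linear functor. -/
def doubleCoset {ι : Type w} [LinearOrder ι] [WellFoundedLT ι] (σ : Equiv.Perm ι) :
    Subfunctor (glFunctor.{w, v, u} k ι) where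
  obj R := {g : GLGroup ι R | ∃ b ∈ upperTriangular ι R, ∃ c ∈ upperTriangular ι R,
    g = b * permMatrix R σ * c}
  map := by
    rintro R S φ _ ⟨b, hb, c, hc, rfl⟩
    refine ⟨_, upperTriangular_map φ.hom.toRingHom hb, _,
      upperTriangular_map φ.hom.toRingHom hc, ?_⟩
    rw [← permMatrix_map φ.hom.toRingHom σ, ← map_mul, ← map_mul]
    rfl

end GeneralLinear

/-- The set `I_s` of successor elements: those having an immediate predecessor. -/
abbrev SuccElts (I : Type w) [LinearOrder I] : Type w := {i : I // ∃ j, j ⋖ i}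

/-! Only the well-order of `I_s` matters. An upper triangular column-finite matrix over a well-order
is invertible iff its diagonal entries are units (`isUnit_of_upper`, `GLGroup.isUnit_diag`).
Disjointness: two factorizations of one matrix give `B * σ = τ * C` with `B`, `C` in the upper
triangular group. Comparing entries shows `τ⁻¹ * σ` moves no element up, and a permutation of a
well-order with this property is the identity. An fppf cover of a nonzero ring has a nonzero member,
so the argument survives sheafification. Covering: elimination is replaced by relative position.
With `T = g⁻¹`, send `j` to the least leading index of a vector `v` such that `T v` has leading
index `j`. The same recipe for `T⁻¹` gives the inverse map, hence a permutation `σ`, and the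
minimizing vectors and their images are the columns of the two triangular factors. -/

namespace ColFinMatrix

/-! ### Leading indices and inversion of triangular matrices. -/

variable {ι : Type w} {R : Type v} [CommRing R] [LinearOrder ι]

/-- The vector `v` has leading index `i`: its `i`-th coordinate is nonzero and all later
coordinates vanish. -/
def HasLead (v : ι →₀ R) (i : ι) : Prop := v i ≠ 0 ∧ ∀ k, i < k → v k = 0

theorem exists_hasLead {v : ι →₀ R} (hv : v ≠ 0) : ∃ i, HasLead v i := by
  have hs : v.support.Nonempty := Finsupp.support_nonempty_iff.mpr hv
  refine ⟨v.support.max' hs, Finsupp.mem_support_iff.mp (v.support.max'_mem hs), fun k hk => ?_⟩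
  by_contra h
  exact absurd (v.support.le_max' k (Finsupp.mem_support_iff.mpr h)) (not_le.mpr hk)

theorem HasLead.unique {v : ι →₀ R} {i j : ι} (hi : HasLead v i) (hj : HasLead v j) : i = j := by
  rcases lt_trichotomy i j with h | h | h
  · exact absurd (hi.2 j h) hj.1
  · exact h
  · exact absurd (hj.2 i h) hi.1

/-- Back substitution by transfinite induction: column `j` is `x j j` times the basis vector at `j`
plus finitely many basis vectors of smaller index, whose preimages are already known. Triangularity
and the unit diagonal are carried along so that the lemma applies again to the matrix of the `y`. -/
theorem exists_preimage_single [WellFoundedLT ι] (x : ColFinMatrix ι R)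
    (hx : ∀ i j, j < i → x.entry i j = 0) (hd : ∀ j, IsUnit (x.entry j j)) (j : ι) :
    ∃ y : ι →₀ R, Finsupp.linearCombination R x.col y = Finsupp.single j 1 ∧
      (∀ i, j < i → y i = 0) ∧ IsUnit (y j) := by
  classical
  induction j using WellFoundedLT.induction with
  | ind j ih =>
    choose! y hy hyu _ using ih
    obtain ⟨d, hd⟩ := (hd j).exists_left_inv
    have hmem : ∀ i ∈ (x.col j).support.erase j, i < j := by
      intro i hi
      rw [Finset.mem_erase, Finsupp.mem_support_iff] at hi
      exact lt_of_le_of_ne (not_lt.mp fun h => hi.2 (hx i j h)) hi.1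
    have hsum : ∀ i, j ≤ i → (∑ k ∈ (x.col j).support.erase j, x.col j k • y k) i = 0 := by
      intro i hi
      rw [Finsupp.finsetSum_apply]
      refine Finset.sum_eq_zero fun k hk => ?_
      rw [Finsupp.smul_apply, hyu k (hmem k hk) i (lt_of_lt_of_le (hmem k hk) hi), smul_zero]
    have hcol : x.col j = Finsupp.single j (x.col j j) +
        ∑ k ∈ (x.col j).support.erase j, Finsupp.single k (x.col j k) := by
      have h := Finsupp.single_add_erase j (x.col j)
      conv_lhs => rw [← h]
      congr 1
      conv_lhs => rw [← Finsupp.sum_single ((x.col j).erase j)]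
      rw [Finsupp.sum, Finsupp.support_erase]
      refine Finset.sum_congr rfl fun k hk => ?_
      rw [Finsupp.erase_ne (Finset.ne_of_mem_erase hk)]
    refine ⟨d • (Finsupp.single j 1 - ∑ k ∈ (x.col j).support.erase j, x.col j k • y k),
      ?_, fun i hi => ?_, ?_⟩
    · have h : ∀ k ∈ (x.col j).support.erase j,
          Finsupp.linearCombination R x.col (x.col j k • y k) =
            Finsupp.single k (x.col j k) := by
        intro k hk
        rw [map_smul, hy k (hmem k hk), Finsupp.smul_single, smul_eq_mul, mul_one]
      rw [map_smul, map_sub, map_sum, Finset.sum_congr rfl h,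
        Finsupp.linearCombination_single, one_smul, sub_eq_of_eq_add hcol, Finsupp.smul_single]
      exact congrArg _ hd
    · rw [Finsupp.smul_apply, Finsupp.sub_apply, hsum i hi.le,
        Finsupp.single_eq_of_ne hi.ne', sub_zero, smul_zero]
    · rw [Finsupp.smul_apply, Finsupp.sub_apply, hsum j le_rfl, Finsupp.single_eq_same,
        sub_zero, smul_eq_mul, mul_one]
      exact IsUnit.of_mul_eq_one _ hd

/-- An upper triangular matrix over a well-ordered index set is invertible as soon as its diagonal
entries are units. -/
theorem isUnit_of_upper [WellFoundedLT ι] (x : ColFinMatrix ι R)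
    (hx : ∀ i j, j < i → x.entry i j = 0) (hd : ∀ j, IsUnit (x.entry j j)) : IsUnit x := by
  choose y hy hyu hyd using exists_preimage_single x hx hd
  -- The right inverse `y` is of the same kind, so it has a right inverse `z` too; then `x = z` and
  -- `y` is two-sided.
  choose z hz _ _ using exists_preimage_single ⟨y⟩ (fun i j h => hyu j i h) hyd
  have h1 : x * ⟨y⟩ = 1 := ext_col hy
  have h2 : (⟨y⟩ : ColFinMatrix ι R) * ⟨z⟩ = 1 := ext_col hz
  exact ⟨⟨x, ⟨y⟩, h1, (left_inv_eq_right_inv h1 h2) ▸ h2⟩, rfl⟩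

end ColFinMatrix

/-! ### Disjointness of the double cosets. -/

open ColFinMatrix

theorem GLGroup.isUnit_diag {ι : Type w} [LinearOrder ι] [WellFoundedLT ι] {R : Type v}
    [CommRing R] {x : GLGroup ι R} (hx : x ∈ upperTriangular ι R) (j : ι) :
    IsUnit (x.val.entry j j) := by
  classical
  have h : (x.inv * x.val).entry j j = x.inv.entry j j * x.val.entry j j := by
    rw [mul_entry_eq_finsum]
    refine finsum_eq_single _ j fun n hn => ?_
    rcases lt_or_gt_of_ne hn with h | h
    · rw [x.inv_upper hx n j h, zero_mul]
    · rw [hx n j h, mul_zero]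
  rw [x.inv_val, one_entry, if_pos rfl] at h
  exact IsUnit.of_mul_eq_one_right _ h.symm

theorem mul_permMatrix_entry {ι : Type w} {R : Type v} [CommRing R] (x : ColFinMatrix ι R)
    (σ : Equiv.Perm ι) (i j : ι) :
    (x * (permMatrix R σ).val).entry i j = x.entry i (σ j) := by
  change (Finsupp.linearCombination R x.col (Finsupp.single (σ j) 1)) i = _
  rw [Finsupp.linearCombination_single, one_smul]
  rfl

theorem permMatrix_mul_entry {ι : Type w} {R : Type v} [CommRing R] (x : ColFinMatrix ι R)
    (σ : Equiv.Perm ι) (i j : ι) :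
    ((permMatrix R σ).val * x).entry (σ i) j = x.entry i j := by
  classical
  rw [mul_entry_eq_finsum, finsum_eq_single _ i, permMatrix_entry, if_pos rfl, one_mul]
  intro n hn
  rw [permMatrix_entry, if_neg fun h => hn (σ.injective h).symm, zero_mul]

/-- At the least `j` with `π j < j`, the element `π j` would already be fixed, contradicting
injectivity. -/
theorem Equiv.Perm.eq_one_of_apply_le {ι : Type w} [LinearOrder ι] [WellFoundedLT ι]
    (π : Equiv.Perm ι) (h : ∀ j, π j ≤ j) : π = 1 := by
  ext j
  induction j using WellFoundedLT.induction with
  | ind j ih =>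
    refine (h j).eq_of_not_lt fun hlt => ?_
    exact hlt.ne (π.injective (ih _ hlt))

/-- Over a nonzero ring, the permutation is determined by its double coset. -/
theorem perm_eq_of_doubleCoset_eq {ι : Type w} [LinearOrder ι] [WellFoundedLT ι] {R : Type v}
    [CommRing R] [Nontrivial R] {σ τ : Equiv.Perm ι} {b c b' c' : GLGroup ι R}
    (hb : b ∈ upperTriangular ι R) (hc : c ∈ upperTriangular ι R)
    (hb' : b' ∈ upperTriangular ι R) (hc' : c' ∈ upperTriangular ι R)
    (h : b * permMatrix R σ * c = b' * permMatrix R τ * c') : σ = τ := by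
  have h1 : (b'⁻¹ * b) * permMatrix R σ = permMatrix R τ * (c' * c⁻¹) := by
    calc (b'⁻¹ * b) * permMatrix R σ = b'⁻¹ * (b * permMatrix R σ * c) * c⁻¹ := by group
      _ = _ := by rw [h]; group
  have hB := mul_mem (inv_mem hb') hb
  have hC := mul_mem hc' (inv_mem hc)
  have h2 : τ⁻¹ * σ = 1 := by
    refine Equiv.Perm.eq_one_of_apply_le _ fun j => not_lt.mp fun hlt => ?_
    -- This is the entry at `(σ j, j)`: a diagonal entry of `b'⁻¹ * b` on the left, hence a unit,
    -- and a below-diagonal entry of `c' * c⁻¹` on the right, hence zero.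
    have h3 := congrArg (fun x : GLGroup ι R => x.val.entry (τ ((τ⁻¹ * σ) j)) j) h1
    simp only [Units.val_mul _ (permMatrix R σ), Units.val_mul (permMatrix R τ)] at h3
    rw [mul_permMatrix_entry, permMatrix_mul_entry, hC _ _ hlt] at h3
    have h4 : τ ((τ⁻¹ * σ) j) = σ j := by simp
    rw [h4] at h3
    exact (GLGroup.isUnit_diag hB (σ j)).ne_zero h3
  exact (inv_mul_eq_one.mp h2).symm

/-- The linear automorphism given by an invertible column-finite matrix. -/
noncomputable def GLGroup.toLinearEquiv {ι : Type w} {K : Type v} [CommRing K] (g : GLGroup ι K) : (ι →₀ K) ≃ₗ[K] (ι →₀ K) :=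
  have key : ∀ x y : ColFinMatrix ι K, x * y = 1 →
      Finsupp.linearCombination K x.col ∘ₗ Finsupp.linearCombination K y.col =
        LinearMap.id := by
    intro x y h
    refine Finsupp.lhom_ext' fun j => LinearMap.ext_ring ?_
    simp only [LinearMap.comp_apply, Finsupp.lsingle_apply, Finsupp.linearCombination_single,
      one_smul, LinearMap.id_apply]
    rw [← mul_col, h, one_col]
  LinearEquiv.ofLinearMap (Finsupp.linearCombination K g.val.col)
    (Finsupp.linearCombination K g.inv.col) (key _ _ g.val_inv) (key _ _ g.inv_val)

/-! ### Relative position of flags and the Bruhat decomposition. -/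

section RelativePosition

variable {ι : Type w} [LinearOrder ι] {K : Type v} [Field K]

/-- If `i` is the least leading index of a vector whose image under `T` has leading index `j`,
then `j` is the least leading index of the image of a vector with leading index `i`. -/
theorem le_of_minimal_lead (T : (ι →₀ K) ≃ₗ[K] (ι →₀ K)) {i j : ι} {v : ι →₀ K}
    (hv : HasLead v i) (hTv : HasLead (T v) j)
    (hmin : ∀ i' u, HasLead u i' → HasLead (T u) j → i ≤ i')
    {j' : ι} {w : ι →₀ K} (hw : HasLead w i) (hTw : HasLead (T w) j') : j ≤ j' := by
  by_contra! hlt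
  -- Subtracting this multiple of `w` kills coordinate `i` of `v`; as `j' < j`, it leaves the lead
  -- of `T v` unchanged, so the difference violates the minimality of `i`.
  have hTu : HasLead (T (v - (v i / w i) • w)) j := by
    rw [map_sub, map_smul]
    refine ⟨?_, fun k hk => ?_⟩
    · rw [Finsupp.sub_apply, Finsupp.smul_apply, hTw.2 j hlt, smul_zero, sub_zero]
      exact hTv.1
    · rw [Finsupp.sub_apply, Finsupp.smul_apply, hTw.2 k (hlt.trans hk), hTv.2 k hk, smul_zero,
        sub_zero]
  obtain ⟨i', hi'⟩ : ∃ i', HasLead (v - (v i / w i) • w) i' := by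
    refine exists_hasLead fun h => hTu.1 ?_
    rw [h, map_zero, Finsupp.zero_apply]
  have hle := hmin i' _ hi' hTu
  refine hi'.1 ?_
  rw [Finsupp.sub_apply, Finsupp.smul_apply, smul_eq_mul]
  rcases hle.eq_or_lt with rfl | hlt'
  · rw [div_mul_cancel₀ _ hw.1, sub_self]
  · rw [hv.2 i' hlt', hw.2 i' hlt', mul_zero, sub_zero]

variable [WellFoundedLT ι]

/-- The preimage of the basis vector at `j` provides a candidate; well-ordering then provides the
least one. -/
theorem exists_minimal_lead (T : (ι →₀ K) ≃ₗ[K] (ι →₀ K)) (j : ι) :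
    ∃ i v, HasLead v i ∧ HasLead (T v) j ∧
      ∀ i' u, HasLead u i' → HasLead (T u) j → i ≤ i' := by
  classical
  have hne : {i : ι | ∃ v, HasLead v i ∧ HasLead (T v) j}.Nonempty := by
    have h0 : T.symm (Finsupp.single j 1) ≠ 0 := by simp
    obtain ⟨i, hi⟩ := exists_hasLead h0
    refine ⟨i, _, hi, ?_⟩
    rw [LinearEquiv.apply_symm_apply]
    refine ⟨by simp, fun k hk => Finsupp.single_eq_of_ne hk.ne'⟩
  obtain ⟨v, hv, hTv⟩ := wellFounded_lt.min_mem _ hne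
  exact ⟨_, v, hv, hTv, fun i' u hu hTu => not_lt.mp (wellFounded_lt.not_lt_min
    {i : ι | ∃ v, HasLead v i ∧ HasLead (T v) j} ⟨u, hu, hTu⟩)⟩

/-- The relative position of the standard flag and its preimage under `T`. -/
theorem exists_perm_hasLead (T : (ι →₀ K) ≃ₗ[K] (ι →₀ K)) :
    ∃ (σ : Equiv.Perm ι) (v : ι → ι →₀ K), ∀ j, HasLead (v j) (σ j) ∧ HasLead (T (v j)) j := by
  choose s v hv hTv hs using exists_minimal_lead T
  choose t w hw hTw ht using exists_minimal_lead T.symm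
  -- In each identity one inequality is minimality of the outer map tested on the inner map's
  -- vector; the other is `le_of_minimal_lead`.
  refine ⟨⟨s, t, fun j => ?_, fun i => ?_⟩, v, fun j => ⟨hv j, hTv j⟩⟩
  · refine le_antisymm (ht _ _ _ (hTv j) (by simpa using hv j)) ?_
    exact le_of_minimal_lead T (hv j) (hTv j) (hs j) (hTw (s j)) (by simpa using hw (s j))
  · refine le_antisymm (hs _ _ _ (hTw i) (by simpa using hw i)) ?_
    exact le_of_minimal_lead T.symm (hw i) (hTw i) (ht i) (hTv (t i)) (by simpa using hv (t i))

/-- The Bruhat decomposition over a field. -/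
theorem GLGroup.exists_bruhat (g : GLGroup ι K) :
    ∃ σ : Equiv.Perm ι, ∃ b ∈ upperTriangular ι K, ∃ c ∈ upperTriangular ι K,
      g = b * permMatrix K σ * c := by
  obtain ⟨σ, v, hv⟩ := exists_perm_hasLead g.toLinearEquiv.symm
  have hb : ∀ j, HasLead (v (σ.symm j)) j := fun j => by
    simpa using (hv (σ.symm j)).1
  -- The `v j`, reindexed by their leads, form `b`; the `g⁻¹ v j` form `c`. Then `g * c = b * σ`,
  -- since both have columns `v j`.
  obtain ⟨b, hbe⟩ := isUnit_of_upper ⟨fun j => v (σ.symm j)⟩ (fun i j h => (hb j).2 i h)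
    fun j => (hb j).1.isUnit
  obtain ⟨c, hce⟩ := isUnit_of_upper ⟨fun j => g.toLinearEquiv.symm (v j)⟩
    (fun i j h => (hv j).2.2 i h) fun j => (hv j).2.1.isUnit
  have hbB : b ∈ upperTriangular ι K := fun i j h => by rw [hbe]; exact (hb j).2 i h
  have hcB : c ∈ upperTriangular ι K := fun i j h => by rw [hce]; exact (hv j).2.2 i h
  refine ⟨σ, b, hbB, c⁻¹, inv_mem hcB, eq_mul_inv_of_mul_eq (Units.ext ?_)⟩
  rw [Units.val_mul, Units.val_mul, hbe, hce]
  refine ColFinMatrix.ext fun i j => ?_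
  rw [mul_permMatrix_entry]
  change g.toLinearEquiv (g.toLinearEquiv.symm (v j)) i = v (σ.symm (σ j)) i
  rw [LinearEquiv.apply_symm_apply, Equiv.symm_apply_apply]

end RelativePosition

/-! ### Passage to the fppf sheafification. -/

theorem IsFppfCover.exists_nontrivial {k : Type u} [CommRing k] {ι : Type} [Finite ι]
    {R : CommAlgCat.{v} k} [Nontrivial R] {A : ι → CommAlgCat.{v} k} {f : ∀ i, R ⟶ A i}
    (hf : IsFppfCover A f) : ∃ i, Nontrivial (A i) := by
  rw [isFppfCover_iff] at hf
  -- A nonzero ring has a prime, and it lifts to some member of the cover.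
  obtain ⟨i, q, -⟩ := hf.2.2 (Classical.arbitrary _)
  exact ⟨i, q.nontrivial⟩

theorem mainTheorem6 (k : Type u) [CommRing k] (I : Type w) [LinearOrder I] [WellFoundedLT I] :
    (∀ σ τ : Equiv.Perm (SuccElts I), σ ≠ τ →
      SubfunctorsDisjoint (fppfSheafify (doubleCoset.{w, v, u} k σ))
        (fppfSheafify (doubleCoset.{w, v, u} k τ))) ∧
    SubfunctorsCover (fun σ : Equiv.Perm (SuccElts I) =>
      fppfSheafify (doubleCoset.{w, v, u} k σ)) := by
  refine ⟨fun σ τ hne R _ => Set.disjoint_left.mpr fun g hσ hτ => hne ?_, fun R hR => ?_⟩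
  -- The two covering sieves are intersected, so that one cover puts `g` in both double cosets at
  -- once.
  · obtain ⟨ι, hι, A, f, hf, hS⟩ := (fppfTopology k).intersection_covering hσ hτ
    obtain ⟨i, hi⟩ := hf.exists_nontrivial
    obtain ⟨⟨b, hb, c, hc, h⟩, b', hb', c', hc', h'⟩ := hS i
    exact perm_eq_of_doubleCoset_eq hb hc hb' hc' (h.symm.trans h')
  · let := hR.toField
    refine Set.eq_univ_of_forall fun g => Set.mem_iUnion.mpr ?_
    obtain ⟨σ, h⟩ := GLGroup.exists_bruhat (K := R) g
    exact ⟨σ, Subfunctor.le_sheafify (fppfTopology k) _ _ h⟩
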